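/- Let $N\ge 0$ be an integer, and let $\mathbb{R}^N$ carry the Euclidean inner product and the Euclidean norm $\|\cdot\|$. Let $B$ be a positive diagonal $N\times N$ matrix, i.e. a real diagonal matrix with strictly positive diagonal entries $b_i$, and for real $s$ let $B^{s}$ be the diagonal matrix with diagonal entries $b_i^{s}$. Let $G:\mathbb{R}^N\to\mathbb{R}^N$ be a continuous mapping that is energy-preserving, i.e. $\mathbf{x}^{\mathrm T}G(\mathbf{x})=0$ for all $\mathbf{x}\in\mathbb{R}^N$. Then for every $\mathbf{F}\in\mathbb{R}^N$ there exists a solution $\mathbf{x}\in\mathbb{R}^N$ of the equation $$0 = G(\mathbf{x}) - B\mathbf{x} + \mathbf{F},$$ and every solution $\mathbf{x}\in\mathbb{R}^N$ of this equation satisfies $$\|B^{1/2}\mathbf{x}\|\le\|B^{-1/2}\mathbf{F}\|.$$ -/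

import Mathlib

/-- A mapping `G : ℝ^N → ℝ^N` is energy-preserving if `xᵀ G(x) = 0` for all `x`. -/
def EnergyPreserving {N : ℕ} (G : EuclideanSpace ℝ (Fin N) → EuclideanSpace ℝ (Fin N)) : Prop :=
  ∀ x, inner ℝ x (G x) = 0

/-- A positive diagonal matrix: diagonal, with strictly positive diagonal entries. -/
def IsPosDiagonal {N : ℕ} (B : Matrix (Fin N) (Fin N) ℝ) : Prop :=
  B.IsDiag ∧ ∀ i, 0 < B i i

/-- The real power `B ^ s` of a positive diagonal matrix `B`: the diagonal matrix whose diagonal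
entries are the `s`-th powers of those of `B`. -/
noncomputable def diagPow {N : ℕ} (B : Matrix (Fin N) (Fin N) ℝ) (s : ℝ) :
    Matrix (Fin N) (Fin N) ℝ :=
  Matrix.diagonal fun i => B i i ^ s

/-- `B^{1/2}` is a positive semidefinite square root of `B`, hence the principal square root. -/
theorem diagPow_half {N : ℕ} {B : Matrix (Fin N) (Fin N) ℝ} (hB : IsPosDiagonal B) :
    (diagPow B (1 / 2)).PosSemidef ∧ diagPow B (1 / 2) * diagPow B (1 / 2) = B := by
  refine ⟨Matrix.PosSemidef.diagonal fun i => Real.rpow_nonneg (hB.2 i).le _, ?_⟩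
  conv_rhs => rw [← hB.1.diagonal_diag]
  rw [diagPow, Matrix.diagonal_mul_diagonal]
  congr 1
  funext i
  rw [← Real.rpow_add (hB.2 i)]
  norm_num [Matrix.diag]

/-- `B^{-1/2}` is the inverse of `B^{1/2}`. -/
theorem diagPow_neg_half {N : ℕ} {B : Matrix (Fin N) (Fin N) ℝ} (hB : IsPosDiagonal B) :
    diagPow B (-(1 / 2)) * diagPow B (1 / 2) = 1 := by
  rw [diagPow, diagPow, Matrix.diagonal_mul_diagonal, ← Matrix.diagonal_one]
  congr 1
  funext i
  rw [← Real.rpow_add (hB.2 i)]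
  norm_num

open MeasureTheory Metric Set

/-! Pairing the equation with `x` removes `G`, leaving ⟨x, Bx⟩ = ⟨x, F⟩ = ⟨B^{1/2}x, B^{-1/2}F⟩;
Cauchy–Schwarz gives the bound. For existence, the field Bx - G(x) - F points outwards far from 0,
so it has a zero by a no-retraction argument in the style of Milnor and Rogers: a zero-free `C¹` map
fixing a sphere would normalise to a map f into the sphere, whose Jacobian vanishes. But for small
t, id + t(f - id) is a bijection of the ball, so its Jacobian integrates to the volume; being
polynomial in t, the integral is the volume at t = 1 too. -/

/-- The determinant of `1 + A` is a fixed affine combination of the determinants of `1 + t A` for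
arbitrarily small positive `t`, since `t ↦ det (1 + t A)` is a polynomial of bounded degree. -/
theorem exists_det_one_add_eq_sum (E : Type*) [NormedAddCommGroup E] [NormedSpace ℝ E]
    [FiniteDimensional ℝ E] {δ : ℝ} (hδ : 0 < δ) :
    ∃ (s : Finset ℝ) (w : ℝ → ℝ), (∀ t ∈ s, 0 < t ∧ t < δ) ∧
      ∀ A : E →L[ℝ] E, (1 + A).det = ∑ t ∈ s, w t * (1 + t • A).det := by
  -- The degree is at most `finrank`, so `finrank + 1` nodes suffice for Lagrange interpolation at
  -- 1.
  obtain ⟨s, hs, hcard⟩ := (Set.Ioo_infinite hδ).exists_subset_card_eq (Module.finrank ℝ E + 1)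
  refine ⟨s, fun t => (Lagrange.basis s id t).eval 1, fun t ht => hs ht, fun A => ?_⟩
  let b := Module.finBasis ℝ E
  let M := LinearMap.toMatrix b b (A : E →ₗ[ℝ] E)
  let p : Polynomial ℝ := Matrix.det ((Polynomial.X : Polynomial ℝ) • M.map Polynomial.C +
    (1 : Matrix _ _ ℝ).map Polynomial.C)
  have hp (t : ℝ) : p.eval t = (1 + t • A).det := by
    have h : (1 + t • A).det = (t • M + 1).det := by
      rw [ContinuousLinearMap.det, ← LinearMap.det_toMatrix b]
      congr 1
      simp [M, LinearMap.toMatrix_one, add_comm, ContinuousLinearMap.one_def,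
          ← Module.End.one_eq_id]
    rw [h]
    simp only [p, ← Polynomial.coe_evalRingHom, RingHom.map_det]
    congr 1
    ext i j
    obtain rfl | hij := eq_or_ne i j
    · simp [mul_comm t]
    · simp [hij, mul_comm t]
  have hdeg : p.degree < s.card := by
    rw [hcard]
    refine Polynomial.degree_le_natDegree.trans_lt ?_
    have := Polynomial.natDegree_det_X_add_C_le M 1
    rw [Fintype.card_fin] at this
    exact_mod_cast Nat.lt_succ_of_le this
  have h1 := congrArg (Polynomial.eval 1)
    (Lagrange.eq_interpolate (v := id) (Set.injOn_id _) hdeg)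
  rw [hp, one_smul, Lagrange.interpolate_apply, Polynomial.eval_finsetSum] at h1
  rw [h1]
  refine Finset.sum_congr rfl fun t _ => ?_
  rw [Polynomial.eval_mul, Polynomial.eval_C, id, hp, mul_comm]

/-- A map that is Lipschitz on a closed ball and vanishes on its boundary sphere stays Lipschitz
when extended by zero. -/
theorem LipschitzOnWith.lipschitzWith_indicator_closedBall {E : Type*} [NormedAddCommGroup E]
    [NormedSpace ℝ E] {F : Type*} [NormedAddCommGroup F] {g : E → F} {K : NNReal} {R : ℝ}
    (hg : LipschitzOnWith K g (closedBall 0 R)) (hg0 : ∀ x ∈ sphere (0 : E) R, g x = 0) :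
    LipschitzWith K ((closedBall 0 R).indicator g) := by
  have key : ∀ x ∈ closedBall (0 : E) R, ∀ y ∉ closedBall (0 : E) R,
      ‖g x‖ ≤ K * dist x y := by
    intro x hx y hy
    rw [mem_closedBall_zero_iff] at hx hy
    -- The segment from `x` to `y` meets the sphere, where `g` vanishes.
    obtain ⟨t, ht, htR⟩ : R ∈ (fun t : ℝ => ‖AffineMap.lineMap x y t‖) '' Icc 0 1 := by
      apply intermediate_value_Icc zero_le_one
      · exact (by fun_prop : Continuous fun t : ℝ => ‖AffineMap.lineMap x y t‖).continuousOn
      · simp [hx, (not_le.1 hy).le]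
    set z := AffineMap.lineMap x y t
    have hz : z ∈ sphere (0 : E) R := by simpa using htR
    calc ‖g x‖ = dist (g x) (g z) := by rw [hg0 z hz, dist_zero_right]
      _ ≤ K * dist x z := hg.dist_le_mul x (by simpa using hx) z (sphere_subset_closedBall hz)
      _ ≤ K * dist x y := by
        gcongr
        rw [dist_left_lineMap, Real.norm_of_nonneg ht.1]
        exact mul_le_of_le_one_left dist_nonneg ht.2
  refine LipschitzWith.of_dist_le_mul fun x y => ?_
  by_cases hx : x ∈ closedBall (0 : E) R <;> by_cases hy : y ∈ closedBall (0 : E) R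
  · simpa only [indicator_of_mem, hx, hy] using hg.dist_le_mul x hx y hy
  · simpa only [indicator_of_mem hx, indicator_of_notMem hy, dist_zero_right] using key x hx y hy
  · simpa only [indicator_of_mem hy, indicator_of_notMem hx, dist_zero_left, dist_comm x] using
      key y hy x hx
  · simp only [indicator_of_notMem hx, indicator_of_notMem hy, dist_self]
    positivity

/-- A contractive perturbation of the identity by a map vanishing on the boundary of a ball maps
the ball bijectively onto itself. -/
theorem LipschitzOnWith.bijOn_add_closedBall {E : Type*} [NormedAddCommGroup E]
    [NormedSpace ℝ E] [CompleteSpace E] {g : E → E} {K : NNReal} {R : ℝ} (hK : K < 1)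
    (hg : LipschitzOnWith K g (closedBall 0 R)) (hg0 : ∀ x ∈ sphere (0 : E) R, g x = 0) :
    BijOn (fun x => x + g x) (closedBall 0 R) (closedBall 0 R) := by
  set G := (closedBall (0 : E) R).indicator g with hG
  have hL : LipschitzWith K G := hg.lipschitzWith_indicator_closedBall hg0
  -- Extending by zero lets Banach's theorem run on all of `E`, with no invariant ball needed.
  have hc (y : E) : ContractingWith K (fun x => y - G x) :=
    ⟨hK, LipschitzWith.of_dist_le_mul fun a b => by
      simpa only [dist_sub_left] using hL.dist_le_mul a b⟩
  have hinj {a b : E} (h : a + G a = b + G b) : a = b :=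
    (hc (b + G b)).fixedPoint_unique' (by simp [Function.IsFixedPt, ← h])
      (by simp [Function.IsFixedPt])
  have hin {x : E} (hx : x ∈ closedBall (0 : E) R) : G x = g x := indicator_of_mem hx g
  have hout {x : E} (hx : x ∉ closedBall (0 : E) R) : G x = 0 := indicator_of_notMem hx g
  refine ⟨fun x hx => ?_, fun a ha b hb h => hinj ?_, fun y hy => ?_⟩
  · by_contra h
    change x + g x ∉ closedBall 0 R at h
    refine h ?_
    rwa [show x + g x = x from (hinj (by rw [hout h, hin hx, add_zero]))]
  · simpa only [hin ha, hin hb] using h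
  · have hfix : y - G (ContractingWith.fixedPoint _ (hc y)) = ContractingWith.fixedPoint _ (hc y) :=
      ContractingWith.fixedPoint_isFixedPt (hc y)
    set x := ContractingWith.fixedPoint _ (hc y)
    have hx : x ∈ closedBall (0 : E) R := by
      by_contra hx
      rw [hout hx, sub_zero] at hfix
      exact hx (hfix ▸ hy)
    refine ⟨x, hx, ?_⟩
    rw [hin hx] at hfix
    exact (sub_eq_iff_eq_add.1 hfix).symm

/-- If a `C¹` map fixes the boundary of a ball then the integral of its Jacobian determinant over
the ball is the volume of the ball. -/
theorem setIntegral_det_fderiv_closedBall {E : Type*} [NormedAddCommGroup E]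
    [NormedSpace ℝ E] [FiniteDimensional ℝ E] [MeasurableSpace E] [BorelSpace E]
    (μ : Measure E) [μ.IsAddHaarMeasure] {f : E → E} {R : ℝ}
    (hf : ∀ x ∈ closedBall (0 : E) R, DifferentiableAt ℝ f x)
    (hf' : ContinuousOn (fderiv ℝ f) (closedBall 0 R)) (hfix : ∀ x ∈ sphere (0 : E) R, f x = x) :
    ∫ x in closedBall 0 R, (fderiv ℝ f x).det ∂μ = μ.real (closedBall 0 R) := by
  have hcpt := isCompact_closedBall (0 : E) R
  set A : E → E →L[ℝ] E := fun x => fderiv ℝ f x - 1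
  have hA : ContinuousOn A (closedBall 0 R) := hf'.sub continuousOn_const
  have hgder : ∀ x ∈ closedBall (0 : E) R, HasFDerivAt (fun x => f x - x) (A x) x :=
    fun x hx => (hf x hx).hasFDerivAt.sub (hasFDerivAt_id x)
  obtain ⟨C, hC⟩ := hcpt.exists_bound_of_continuousOn hA
  have hC' : ∀ x ∈ closedBall (0 : E) R, ‖A x‖ ≤ max C 1 := fun x hx =>
    (hC x hx).trans (le_max_left _ _)
  have hC0 : 0 < max C 1 := lt_max_of_lt_right one_pos
  obtain ⟨ε, hε, hdet⟩ : ∃ ε > 0, ∀ T : E →L[ℝ] E, ‖T‖ < ε → 0 < (1 + T).det := by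
    have hc : Continuous fun T : E →L[ℝ] E => (1 + T).det :=
      ContinuousLinearMap.continuous_det.comp (continuous_const.add continuous_id)
    have h0 : 0 < (1 + (0 : E →L[ℝ] E)).det := by simp [ContinuousLinearMap.det]
    obtain ⟨ε, hε, h⟩ := Metric.eventually_nhds_iff.1 (hc.continuousAt.eventually_const_lt h0)
    exact ⟨ε, hε, fun T hT => h (by simpa using hT)⟩
  have hint (t : ℝ) : IntegrableOn (fun x => (1 + t • A x).det) (closedBall 0 R) μ :=
    (ContinuousLinearMap.continuous_det.comp_continuousOn
      (continuousOn_const.add (hA.const_smul t))).integrableOn_compact hcpt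
  -- `ε` keeps the determinant positive; 1 makes the perturbation a contraction.
  have hsmall {t : ℝ} (ht : 0 < t) (htδ : t < min ε 1 / max C 1) :
      ∫ x in closedBall 0 R, (1 + t • A x).det ∂μ = μ.real (closedBall 0 R) := by
    rw [lt_div_iff₀ hC0, lt_min_iff] at htδ
    have hn : ∀ x ∈ closedBall (0 : E) R, ‖t • A x‖ ≤ t * max C 1 := fun x hx => by
      rw [norm_smul, Real.norm_of_nonneg ht.le]
      gcongr
      exact hC' x hx
    have hder : ∀ x ∈ closedBall (0 : E) R,
        HasFDerivAt (fun x => t • (f x - x)) (t • A x) x := fun x hx => (hgder x hx).const_smul t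
    have hL : LipschitzOnWith (t * max C 1).toNNReal (fun x => t • (f x - x)) (closedBall 0 R) :=
      (convex_closedBall 0 R).lipschitzOnWith_of_nnnorm_hasFDerivWithin_le
        (fun x hx => (hder x hx).hasFDerivWithinAt)
        (fun x hx => NNReal.le_toNNReal_of_coe_le (hn x hx))
    have hbij := hL.bijOn_add_closedBall (Real.toNNReal_lt_one.2 htδ.2)
      (fun x hx => by simp [hfix x hx])
    have hcv := integral_image_eq_integral_abs_det_fderiv_smul μ measurableSet_closedBall
      (fun x hx => ((hasFDerivAt_id x).add (hder x hx)).hasFDerivWithinAt) hbij.injOn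
      (fun _ => (1 : ℝ))
    rw [show (id + fun x => t • (f x - x)) = fun x => x + t • (f x - x) from rfl,
      hbij.image_eq, setIntegral_const, smul_eq_mul, mul_one] at hcv
    rw [hcv]
    refine setIntegral_congr_fun measurableSet_closedBall fun x hx => ?_
    simp only [smul_eq_mul, mul_one]
    exact (abs_of_pos (hdet _ ((hn x hx).trans_lt htδ.1))).symm
  obtain ⟨s, w, hs, hw⟩ := exists_det_one_add_eq_sum E (δ := min ε 1 / max C 1) (by positivity)
  have hw1 : ∑ t ∈ s, w t = 1 := by simpa [ContinuousLinearMap.det] using (hw 0).symm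
  have hfA (x : E) : (fderiv ℝ f x).det = ∑ t ∈ s, w t * (1 + t • A x).det := by
    rw [← hw, add_sub_cancel]
  simp_rw [hfA]
  rw [integral_finsetSum s fun t _ => (hint t).const_mul (w t)]
  simp_rw [integral_const_mul]
  rw [Finset.sum_congr rfl fun t ht => by rw [hsmall (hs t ht).1 (hs t ht).2],
    ← Finset.sum_mul, hw1, one_mul]

/-- A `C¹` map that fixes the boundary of a ball has a zero in the ball. -/
theorem exists_eq_zero_of_contDiff_of_eq_self_on_sphere {E : Type*} [NormedAddCommGroup E]
    [InnerProductSpace ℝ E] [FiniteDimensional ℝ E] {v : E → E} {R : ℝ} (hR : 0 < R)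
    (hv : ContDiff ℝ 1 v) (hfix : ∀ x ∈ sphere (0 : E) R, v x = x) :
    ∃ x ∈ closedBall (0 : E) R, v x = 0 := by
  borelize E
  by_contra! hne
  set f : E → E := fun x => (R / ‖v x‖) • v x
  set U : Set E := {x | v x ≠ 0}
  have hU : IsOpen U := isOpen_ne_fun hv.continuous continuous_const
  have hBU : closedBall (0 : E) R ⊆ U := hne
  have hfU : ContDiffOn ℝ 1 f U :=
    (contDiffOn_const.div (hv.contDiffOn.norm ℝ fun x hx => hx)
      fun x hx => norm_ne_zero_iff.2 hx).smul hv.contDiffOn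
  have hfd : ∀ x ∈ U, DifferentiableAt ℝ f x := fun x hx =>
    (hfU.differentiableOn one_ne_zero).differentiableAt (hU.mem_nhds hx)
  have hnorm : ∀ x ∈ U, inner ℝ (f x) (f x) = R ^ 2 := fun x hx => by
    have : ‖v x‖ ≠ 0 := norm_ne_zero_iff.2 hx
    rw [real_inner_self_eq_norm_sq, norm_smul, norm_div, norm_norm, div_mul_cancel₀ _ this,
      Real.norm_eq_abs, sq_abs]
  -- Since ‖f‖² is constant, ⟨f x, f'(x)h⟩ = 0 for all h, so an invertible f'(x) would force f x =
  -- 0.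
  have hdet : ∀ x ∈ closedBall (0 : E) R, (fderiv ℝ f x).det = 0 := fun x hx => by
    by_contra h
    obtain ⟨h', hh'⟩ : ∃ h', fderiv ℝ f x h' = f x :=
      (LinearMap.equivOfDetNeZero (fderiv ℝ f x : E →ₗ[ℝ] E) h).surjective (f x)
    have hd := (hfd x (hBU hx)).hasFDerivAt
    have h1 := (hd.inner ℝ hd).congr_of_eventuallyEq (f₁ := fun _ => R ^ 2)
      (Filter.eventuallyEq_of_mem (hU.mem_nhds (hBU hx)) fun y hy => (hnorm y hy).symm)
    have h2 := DFunLike.congr_fun (h1.unique (hasFDerivAt_const (R ^ 2) x)) h'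
    simp [fderivInnerCLM_apply, hh', hnorm x (hBU hx), -inner_self_eq_norm_sq_to_K] at h2
    nlinarith [hnorm x (hBU hx), sq_pos_of_pos hR]
  have hvol := setIntegral_det_fderiv_closedBall (volume : Measure E) (f := f) (R := R)
    (fun x hx => hfd x (hBU hx)) ((hfU.continuousOn_fderiv_of_isOpen hU le_rfl).mono hBU)
    fun x hx => by
      rw [mem_sphere_zero_iff_norm] at hx
      simp only [f, hfix x (mem_sphere_zero_iff_norm.2 hx), hx, div_self hR.ne', one_smul]
  rw [setIntegral_congr_fun measurableSet_closedBall hdet, integral_zero] at hvol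
  exact (ENNReal.toReal_pos (measure_closedBall_pos volume (0 : E) hR).ne'
    measure_closedBall_lt_top.ne).ne hvol

/-- A continuous vector field pointing outwards outside of some ball has a zero. -/
theorem exists_eq_zero_of_continuous_of_inner_pos {E : Type*} [NormedAddCommGroup E]
    [InnerProductSpace ℝ E] [FiniteDimensional ℝ E] {Φ : E → E} {r : ℝ} (hr : 0 < r)
    (hΦ : Continuous Φ) (hpos : ∀ x, r ≤ ‖x‖ → 0 < inner ℝ x (Φ x)) : ∃ x, Φ x = 0 := by
  by_contra! hne
  obtain ⟨e, he, hle⟩ := (isCompact_closedBall (0 : E) r).exists_forall_le' (a := (0 : ℝ))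
    hΦ.norm.continuousOn fun x _ => norm_pos_iff.2 (hne x)
  obtain ⟨c, hc, hlc⟩ := ((isCompact_closedBall (0 : E) (2 * r)).inter_right
    (isClosed_le continuous_const continuous_norm : IsClosed {x : E | r ≤ ‖x‖})).exists_forall_le'
    (a := (0 : ℝ)) (continuous_id.inner (𝕜 := ℝ) hΦ).continuousOn fun x hx => hpos x hx.2
  -- Closeness `e` keeps `p` nonzero on the inner ball; `c / (2 * r)` keeps it outward on the shell.
  obtain ⟨p, hp, hpΦ, -⟩ := hΦ.exists_contDiff_approx 1 (ε := fun _ => min e (c / (2 * r)))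
    continuous_const fun _ => by positivity
  -- The bump blends `p` into the identity across the shell, where both point outwards.
  let φ : ContDiffBump (0 : E) := ⟨r, 2 * r, hr, by linarith⟩
  obtain ⟨x, hx, hx0⟩ := exists_eq_zero_of_contDiff_of_eq_self_on_sphere (R := 2 * r)
    (v := fun x => φ x • p x + (1 - φ x) • x) (by positivity)
    ((φ.contDiff.smul hp).add ((contDiff_const.sub φ.contDiff).smul contDiff_id))
    fun x hx => by
      simp [φ.zero_of_le_dist (x := x) (mem_sphere.1 hx).ge]
  have hd := lt_min_iff.1 (hpΦ x)
  rw [dist_eq_norm] at hd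
  rcases le_total ‖x‖ r with h | h
  · have hxr : x ∈ closedBall (0 : E) r := mem_closedBall_zero_iff.2 h
    rw [φ.one_of_mem_closedBall hxr, sub_self, zero_smul, add_zero, one_smul] at hx0
    rw [hx0, zero_sub, norm_neg] at hd
    exact (hle x hxr).not_gt hd.1
  · have hx2 : ‖x‖ ≤ 2 * r := mem_closedBall_zero_iff.1 hx
    have hin : 0 < inner ℝ x (p x) := by
      have h1 : c ≤ inner ℝ x (Φ x) := hlc x ⟨hx, h⟩
      have h2 : -(‖x‖ * ‖p x - Φ x‖) ≤ inner ℝ x (p x - Φ x) :=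
        (abs_le.1 (abs_real_inner_le_norm x (p x - Φ x))).1
      have h3 : ‖x‖ * ‖p x - Φ x‖ < c := by
        have := (lt_div_iff₀ (by positivity)).1 hd.2
        nlinarith [norm_nonneg (p x - Φ x)]
      rw [inner_sub_right] at h2
      linarith
    have h0 := congrArg (inner ℝ x) hx0
    rw [inner_add_right, real_inner_smul_right, real_inner_smul_right, inner_zero_right,
      real_inner_self_eq_norm_sq] at h0
    have hsq : 0 < ‖x‖ ^ 2 := by
      have := hr.trans_le h
      positivity
    rcases (φ.nonneg (x := x)).eq_or_lt with hφ | hφ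
    · rw [← hφ] at h0
      linarith
    · have := mul_pos hφ hin
      have := mul_nonneg (sub_nonneg.2 (φ.le_one (x := x))) hsq.le
      linarith

/-! ### Positive diagonal matrices as operators -/

theorem toEuclideanCLM_apply_of_isDiag {N : ℕ} {B : Matrix (Fin N) (Fin N) ℝ} (hB : B.IsDiag)
    (x : EuclideanSpace ℝ (Fin N)) (i : Fin N) :
    Matrix.toEuclideanCLM (𝕜 := ℝ) B x i = B i i * x i := by
  rw [Matrix.ofLp_toEuclideanCLM, ← hB.diagonal_diag, Matrix.mulVec_diagonal]
  simp

theorem toEuclideanCLM_diagPow_apply {N : ℕ} (B : Matrix (Fin N) (Fin N) ℝ) (s : ℝ)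
    (x : EuclideanSpace ℝ (Fin N)) (i : Fin N) :
    Matrix.toEuclideanCLM (𝕜 := ℝ) (diagPow B s) x i = B i i ^ s * x i := by
  rw [diagPow, toEuclideanCLM_apply_of_isDiag (Matrix.isDiag_diagonal _), Matrix.diagonal_apply_eq]

theorem IsPosDiagonal.exists_mul_sq_norm_le_inner {N : ℕ} {B : Matrix (Fin N) (Fin N) ℝ}
    (hB : IsPosDiagonal B) :
    ∃ β > 0, ∀ x : EuclideanSpace ℝ (Fin N),
      β * ‖x‖ ^ 2 ≤ inner ℝ x (Matrix.toEuclideanCLM (𝕜 := ℝ) B x) := by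
  obtain ⟨β, hβ, hle⟩ : ∃ β > 0, ∀ i, β ≤ B i i := by
    obtain ⟨β, hβ, h⟩ := (isCompact_univ (X := Fin N)).exists_forall_le' (a := (0 : ℝ))
      (f := fun i => B i i) continuous_of_discreteTopology.continuousOn fun i _ => hB.2 i
    exact ⟨β, hβ, fun i => h i trivial⟩
  refine ⟨β, hβ, fun x => ?_⟩
  rw [EuclideanSpace.real_norm_sq_eq, Finset.mul_sum, PiLp.inner_apply]
  refine Finset.sum_le_sum fun i _ => ?_
  rw [toEuclideanCLM_apply_of_isDiag hB.1]
  simp only [RCLike.inner_apply, conj_trivial]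
  nlinarith [hle i, sq_nonneg (x i)]

theorem IsPosDiagonal.sq_norm_diagPow_half {N : ℕ} {B : Matrix (Fin N) (Fin N) ℝ}
    (hB : IsPosDiagonal B) (x : EuclideanSpace ℝ (Fin N)) :
    ‖Matrix.toEuclideanCLM (𝕜 := ℝ) (diagPow B (1 / 2)) x‖ ^ 2 =
      inner ℝ x (Matrix.toEuclideanCLM (𝕜 := ℝ) B x) := by
  rw [EuclideanSpace.real_norm_sq_eq, PiLp.inner_apply]
  refine Finset.sum_congr rfl fun i _ => ?_
  rw [toEuclideanCLM_diagPow_apply, toEuclideanCLM_apply_of_isDiag hB.1, ← Real.sqrt_eq_rpow,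
    mul_pow, Real.sq_sqrt (hB.2 i).le]
  simp only [RCLike.inner_apply, conj_trivial]
  ring

theorem IsPosDiagonal.inner_diagPow_half_diagPow_neg_half {N : ℕ} {B : Matrix (Fin N) (Fin N) ℝ}
    (hB : IsPosDiagonal B) (x y : EuclideanSpace ℝ (Fin N)) :
    inner ℝ (Matrix.toEuclideanCLM (𝕜 := ℝ) (diagPow B (1 / 2)) x)
      (Matrix.toEuclideanCLM (𝕜 := ℝ) (diagPow B (-(1 / 2))) y) = inner ℝ x y := by
  rw [PiLp.inner_apply, PiLp.inner_apply]
  refine Finset.sum_congr rfl fun i _ => ?_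
  have h : B i i ^ (-(1 / 2) : ℝ) * B i i ^ (1 / 2 : ℝ) = 1 := by
    rw [← Real.rpow_add (hB.2 i), neg_add_cancel, Real.rpow_zero]
  rw [toEuclideanCLM_diagPow_apply, toEuclideanCLM_diagPow_apply]
  simp only [RCLike.inner_apply, conj_trivial]
  linear_combination (x i * y i) * h

theorem mainTheorem4 (N : ℕ) (B : Matrix (Fin N) (Fin N) ℝ) (hB : IsPosDiagonal B)
    (G : EuclideanSpace ℝ (Fin N) → EuclideanSpace ℝ (Fin N))
    (hGcont : Continuous G) (hG : EnergyPreserving G) (F : EuclideanSpace ℝ (Fin N)) :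
    (∃ x : EuclideanSpace ℝ (Fin N), 0 = G x - Matrix.toEuclideanCLM (𝕜 := ℝ) B x + F) ∧
    ∀ x : EuclideanSpace ℝ (Fin N), 0 = G x - Matrix.toEuclideanCLM (𝕜 := ℝ) B x + F →
      ‖Matrix.toEuclideanCLM (𝕜 := ℝ) (diagPow B (1 / 2)) x‖ ≤
        ‖Matrix.toEuclideanCLM (𝕜 := ℝ) (diagPow B (-(1 / 2))) F‖ := by
  constructor
  · obtain ⟨β, hβ, hle⟩ := hB.exists_mul_sq_norm_le_inner
    -- Beyond this radius β‖x‖² exceeds ‖x‖‖F‖.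
    have hr : 0 < (‖F‖ + 1) / β := by positivity
    obtain ⟨x, hx⟩ := exists_eq_zero_of_continuous_of_inner_pos
      (Φ := fun x => Matrix.toEuclideanCLM (𝕜 := ℝ) B x - G x - F) hr
      (((ContinuousLinearMap.continuous _).sub hGcont).sub continuous_const) fun x hx => by
        have h0 : 0 < ‖x‖ := hr.trans_le hx
        rw [div_le_iff₀ hβ] at hx
        rw [inner_sub_right, inner_sub_right, hG x]
        nlinarith [hle x, real_inner_le_norm x F]
    refine ⟨x, ?_⟩
    rw [← neg_eq_zero.2 hx]
    abel
  · intro x hx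
    have h := congrArg (inner ℝ x) hx
    rw [inner_add_right, inner_sub_right, inner_zero_right, hG x] at h
    have hsq := hB.sq_norm_diagPow_half x
    have hxF := real_inner_le_norm (Matrix.toEuclideanCLM (𝕜 := ℝ) (diagPow B (1 / 2)) x)
      (Matrix.toEuclideanCLM (𝕜 := ℝ) (diagPow B (-(1 / 2))) F)
    rw [hB.inner_diagPow_half_diagPow_neg_half] at hxF
    rcases (norm_nonneg (Matrix.toEuclideanCLM (𝕜 := ℝ) (diagPow B (1 / 2)) x)).eq_or_lt
      with h0 | h0
    · exact h0 ▸ norm_nonneg _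
    · exact le_of_mul_le_mul_left (by linarith) h0
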